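/- In a finite graph $G$ every vertex starts with weight $1$. A total acquisition move transfers all the (positive) weight of a vertex $u$ onto a neighbour $v$, provided that immediately before the move the weight of $v$ is at least the weight of $u$. An acquisition protocol is a sequence of such moves made until no further move is possible; the set of vertices with positive weight at its end is called a residual set. The total acquisition number $a_t(G)$ is the minimum size of a residual set of $G$. Let $\mathcal G(n,r)$ be the random geometric graph with vertex set $\{1,\dots,n\}$ whose vertices are located at $n$ independent uniformly random points of $[0,\sqrt n]^2$, two distinct vertices being adjacent if and only if their locations are at Euclidean distance at most $r$. Write $\lg$ for the binary logarithm. **Theorem.** There exist absolute constants $c>1$ and $\delta>0$ such that for every sequence $(r_n)_{n\ge 1}$ of real numbers with $r_n\ge c$ for all $n$, $$\lim_{n\to\infty}\Pr\left[\,a_t\big(\mathcal G(n,r_n)\big)\ \ge\ \delta\,\frac{n}{(r_n\lg r_n)^2}\,\right]=1 .$$ -/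

import Mathlib

open MeasureTheory Filter Topology

namespace SimpleGraph

variable {V : Type*}

/-- A total acquisition move from the weight configuration `w` to `w'`: all the (positive) weight
of some vertex `u` is transferred onto a neighbour `v` whose weight is at least that of `u`. -/
def AcquisitionMove (G : SimpleGraph V) (w w' : V → ℕ) : Prop :=
  ∃ u v : V, G.Adj u v ∧ 0 < w u ∧ w u ≤ w v ∧
    w' u = 0 ∧ w' v = w v + w u ∧ ∀ x : V, x ≠ u → x ≠ v → w' x = w x

/-- `w` is the final weight configuration of an acquisition protocol: it is reached from the
configuration in which every vertex has weight `1` by finitely many total acquisition moves, and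
no further move is possible. -/
def IsAcquisitionOutcome (G : SimpleGraph V) (w : V → ℕ) : Prop :=
  Relation.ReflTransGen G.AcquisitionMove (fun _ => 1) w ∧ ∀ w', ¬ G.AcquisitionMove w w'

/-- `S` is a residual set: the set of vertices with positive weight after some acquisition
protocol. -/
def IsResidualSet (G : SimpleGraph V) (S : Set V) : Prop :=
  ∃ w : V → ℕ, G.IsAcquisitionOutcome w ∧ S = {v | 0 < w v}

/-- The total acquisition number of a (finite) graph: the minimum size of a residual set. -/
noncomputable def totalAcquisitionNumber (G : SimpleGraph V) : ℕ :=
  sInf {k : ℕ | ∃ S : Set V, G.IsResidualSet S ∧ S.ncard = k}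

/-- A finite graph has a residual set, so the minimum above is over a nonempty set. -/
theorem exists_isResidualSet [Finite V] (G : SimpleGraph V) : ∃ S : Set V, G.IsResidualSet S := by
  have key : ∀ (m : ℕ) (w : V → ℕ), {v | 0 < w v}.ncard = m →
      Relation.ReflTransGen G.AcquisitionMove (fun _ => 1) w → ∃ w', G.IsAcquisitionOutcome w' := by
    intro m
    induction m using Nat.strong_induction_on with
    | _ m ih =>
      intro w hm hw
      by_cases h : ∃ w', G.AcquisitionMove w w'
      · obtain ⟨w', hmove⟩ := h
        refine ih _ ?_ w' rfl (hw.tail hmove)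
        obtain ⟨u, v, -, hu, huv, hu', hv', hx⟩ := hmove
        rw [← hm]
        refine Set.ncard_lt_ncard ⟨fun x hpos => ?_, fun hsub => ?_⟩ (Set.toFinite _)
        · simp only [Set.mem_ofPred_eq] at hpos ⊢
          by_cases hxu : x = u
          · rw [hxu]; exact hu
          · by_cases hxv : x = v
            · rw [hxv]; omega
            · rw [← hx x hxu hxv]; exact hpos
        · have h0 : 0 < w' u := hsub (show u ∈ {v | 0 < w v} from hu)
          omega
      · exact ⟨w, hw, fun w' hw' => h ⟨w', hw'⟩⟩
  obtain ⟨w, hw⟩ := key _ _ rfl Relation.ReflTransGen.refl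
  exact ⟨_, w, hw, rfl⟩

/-- The geometric graph with vertex set `V` in which vertex `i` is located at the point `x i` of the
plane: two distinct vertices are adjacent iff their locations are at Euclidean distance at most
`r`. -/
def geometricGraph (x : V → EuclideanSpace ℝ (Fin 2)) (r : ℝ) : SimpleGraph V where
  Adj i j := i ≠ j ∧ Dist.dist (x i) (x j) ≤ r
  symm := ⟨fun _ _ h => ⟨h.1.symm, by rw [_root_.dist_comm]; exact h.2⟩⟩
  loopless := ⟨fun _ h => h.1 rfl⟩

end SimpleGraph

/-- The square `[0, √n]²`. -/
def rggSquare (n : ℕ) : Set (EuclideanSpace ℝ (Fin 2)) :=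
  {p | ∀ i, p i ∈ Set.Icc 0 (Real.sqrt n)}

/-- The joint law of `n` independent uniformly random points of the square `[0, √n]²`
(for `n ≥ 1`). -/
noncomputable def rggPoints (n : ℕ) : Measure (Fin n → EuclideanSpace ℝ (Fin 2)) :=
  Measure.pi fun _ => ProbabilityTheory.cond volume (rggSquare n)

/-! Each move onto a vertex at least doubles the incoming weight, so a unit that has travelled `h`
hops sits in a weight of at least `2 ^ h`. A final weight `w` is therefore drawn from a disc of
radius about `r lg w`, whose expected population, of order `(r lg w)²`, is much smaller than `w`
once `w ≥ 2 ^ L` with `2 ^ L` a large multiple of `(r L)²`. Heavy vertices thus need atypically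
dense discs and should carry only a fraction of the total weight `n`; the rest sits on vertices
lighter than `2 ^ L`, of which there must be order `n / 2 ^ L`.

To treat all scales of `w` at once, `card_le_of_reachable` bounds the heavy weight by a double sum
of an exponential kernel of range `r L`. Its mean is a small multiple of `n` and its variance is
`O(n)` (`variance_sum_pairTerm_le`), so Chebyshev's inequality concludes. `exists_hop_scale`
provides `L` with `2 ^ L` of order `(r lg r)²`. -/

/-! ### Deterministic part: hops, weights and the kernel bound. -/

/-- In every configuration reachable by total acquisition moves in a geometric graph, each unit of
weight at `v` started within `h v` hops of length at most `r`, and the weight of `v` is at least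
`2 ^ h v`. -/
theorem exists_owner_of_reachable {V : Type*} [Fintype V] [DecidableEq V]
    (x : V → EuclideanSpace ℝ (Fin 2)) (r : ℝ) {w : V → ℕ}
    (hw : Relation.ReflTransGen (SimpleGraph.geometricGraph x r).AcquisitionMove (fun _ => 1) w) :
    ∃ (σ : V → V) (h : V → ℕ), (∀ v, w v = (Finset.univ.filter fun y => σ y = v).card) ∧
      (∀ v, 0 < w v → 2 ^ h v ≤ w v) ∧ ∀ y, dist (x y) (x (σ y)) ≤ h (σ y) * r := by
  induction hw with
  | refl =>
    exact ⟨id, fun _ => 0, fun v => by simp [Finset.filter_eq'], by simp, by simp⟩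
  | @tail w w' _ hmove ih =>
    obtain ⟨σ, h, hcard, hpow, hdist⟩ := ih
    obtain ⟨u, v, ⟨huv, hr⟩, hu, hle, hu', hv', hrest⟩ := hmove
    have hr0 : 0 ≤ r := dist_nonneg.trans hr
    -- Units at `u` make one more hop, and `2 ^ (h u + 1) ≤ 2 * w u ≤ w u + w v` pays for it. The
    -- stale value `h u` is harmless: `u` owns nothing any more.
    refine ⟨fun y => if σ y = u then v else σ y,
      fun z => if z = v then max (h v) (h u + 1) else h z, fun z => ?_, fun z hz => ?_,
      fun y => ?_⟩
    · by_cases hzu : z = u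
      · subst hzu
        rw [hu', eq_comm, Finset.card_eq_zero, Finset.filter_eq_empty_iff]
        intro y _
        dsimp only
        split_ifs with h1
        · exact huv.symm
        · exact h1
      by_cases hzv : z = v
      · subst hzv
        rw [hv', hcard z, hcard u, ← Finset.card_union_of_disjoint]
        · congr 1
          ext y
          simp only [Finset.mem_union, Finset.mem_filter, Finset.mem_univ, true_and]
          split_ifs with h1 <;> simp [h1]
        · rw [Finset.disjoint_filter]
          intro y _ h1 h2
          exact huv (h2.symm.trans h1)
      · rw [hrest z hzu hzv, hcard z]
        congr 1
        ext y
        simp only [Finset.mem_filter, Finset.mem_univ, true_and]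
        split_ifs with h1
        · exact ⟨fun h2 => absurd (h2.symm.trans h1) hzu, fun h2 => absurd h2.symm hzv⟩
        · rfl
    · by_cases hzv : z = v
      · subst hzv
        have h1 := hpow u hu
        have h2 := hpow z (hu.trans_le hle)
        simp only [if_true]
        rw [hv']
        rcases max_choice (h z) (h u + 1) with h3 | h3 <;> rw [h3]
        · omega
        · rw [pow_succ]; omega
      · have hzu : z ≠ u := by rintro rfl; omega
        simp only [if_neg hzv]
        rw [hrest z hzu hzv] at hz ⊢
        exact hpow z hz
    · by_cases hy : σ y = u
      · simp only [hy, if_true]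
        have h1 := hdist y
        rw [hy] at h1
        have h2 : ((h u + 1 : ℕ) : ℝ) ≤ (max (h v) (h u + 1) : ℕ) := by
          exact_mod_cast le_max_right _ _
        calc dist (x y) (x v) ≤ dist (x y) (x u) + dist (x u) (x v) := dist_triangle _ _ _
          _ ≤ h u * r + r := add_le_add h1 hr
          _ = ((h u + 1 : ℕ) : ℝ) * r := by push_cast; ring
          _ ≤ _ := mul_le_mul_of_nonneg_right h2 hr0
      · simp only [hy, if_false]
        refine (hdist y).trans ?_
        split_ifs with h1
        · rw [h1]
          exact mul_le_mul_of_nonneg_right (by exact_mod_cast le_max_left _ _) hr0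
        · rfl

/-- An exponentially decaying kernel on the plane. -/
noncomputable def expKernel (a : ℝ) (p q : EuclideanSpace ℝ (Fin 2)) : ℝ :=
  ∏ i, Real.exp (-(|p i - q i| / a))

theorem expKernel_pos (a : ℝ) (p q : EuclideanSpace ℝ (Fin 2)) : 0 < expKernel a p q :=
  Finset.prod_pos fun _ _ => Real.exp_pos _

theorem expKernel_le_one {a : ℝ} (ha : 0 ≤ a) (p q : EuclideanSpace ℝ (Fin 2)) :
    expKernel a p q ≤ 1 :=
  Finset.prod_le_one (fun _ _ => (Real.exp_pos _).le) fun _ _ => by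
    rw [Real.exp_le_one_iff, neg_nonpos]
    positivity

theorem expKernel_comm (a : ℝ) (p q : EuclideanSpace ℝ (Fin 2)) :
    expKernel a p q = expKernel a q p := by
  simp only [expKernel, abs_sub_comm]

theorem expKernel_self (a : ℝ) (p : EuclideanSpace ℝ (Fin 2)) : expKernel a p p = 1 := by
  simp [expKernel]

/-- The ℓ¹ form of the kernel makes its integral a product; the factor 2 is the cost of comparing ℓ¹
with the Euclidean distance. -/
theorem exp_neg_le_expKernel {a : ℝ} (ha : 0 < a) (p q : EuclideanSpace ℝ (Fin 2)) :
    Real.exp (-(2 * dist p q / a)) ≤ expKernel a p q := by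
  have h : ∀ i, |p i - q i| ≤ dist p q := fun i => by
    rw [dist_eq_norm]
    exact PiLp.norm_apply_le (p - q) i
  rw [expKernel, ← Real.exp_sum, Real.exp_le_exp, Fin.sum_univ_two, ← neg_add, neg_le_neg_iff,
    ← add_div]
  gcongr
  linarith [h 0, h 1]

/-- Up to `L` hops the exponential costs at most `e ≤ 3`. Each further hop costs `exp (1 / L) ≤ 2`,
which the doubling of the weight absorbs. -/
theorem two_pow_mul_exp_le {L h w : ℕ} (hL : 2 ≤ L) (hLw : 2 ^ L ≤ w) (hw : 2 ^ h ≤ w) :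
    (2 : ℝ) ^ L * Real.exp (h / L) ≤ 3 * w := by
  have hL0 : (0 : ℝ) < L := by positivity
  have hLw' : (2 : ℝ) ^ L ≤ w := by exact_mod_cast hLw
  have hw' : (2 : ℝ) ^ h ≤ w := by exact_mod_cast hw
  have he : Real.exp 1 ≤ 3 := Real.exp_one_lt_three.le
  rcases le_total h L with hle | hle
  · have h1 : Real.exp (h / L) ≤ Real.exp 1 := by
      rw [Real.exp_le_exp, div_le_one hL0]
      exact_mod_cast hle
    calc (2 : ℝ) ^ L * Real.exp (h / L) ≤ w * 3 := by gcongr; exact h1.trans he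
      _ = 3 * w := mul_comm _ _
  · obtain ⟨m, rfl⟩ := Nat.exists_eq_add_of_le hle
    have h2 : Real.exp (1 / L) ≤ 2 := by
      have h3 : Real.exp (1 / L) ^ 2 ≤ 2 ^ 2 := by
        rw [← Real.exp_nat_mul]
        calc Real.exp ((2 : ℕ) * (1 / L)) ≤ Real.exp 1 := by
              rw [Real.exp_le_exp, mul_one_div, div_le_one hL0]
              exact_mod_cast hL
          _ ≤ 2 ^ 2 := by linarith
      exact le_of_sq_le_sq h3 (by norm_num)
    have h4 : Real.exp (((L + m : ℕ) : ℝ) / L) = Real.exp 1 * Real.exp (1 / L) ^ m := by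
      rw [← Real.exp_nat_mul, ← Real.exp_add]
      congr 1
      push_cast
      field_simp
    rw [h4]
    calc (2 : ℝ) ^ L * (Real.exp 1 * Real.exp (1 / L) ^ m) ≤ 2 ^ L * (3 * 2 ^ m) := by gcongr
      _ = 3 * 2 ^ (L + m) := by ring
      _ ≤ 3 * w := by linarith

/-- The vertices of final weight at least `2 ^ L` carry a total weight which is at most a sum over
pairs of points of an exponentially decaying kernel. -/
theorem card_le_of_reachable {V : Type*} [Fintype V]
    (x : V → EuclideanSpace ℝ (Fin 2)) {r : ℝ} (hr : 0 < r) {w : V → ℕ}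
    (hw : Relation.ReflTransGen (SimpleGraph.geometricGraph x r).AcquisitionMove (fun _ => 1) w)
    {L : ℕ} (hL : 2 ≤ L) :
    (Fintype.card V : ℝ) ≤ 2 ^ L * ({v | 0 < w v}.ncard : ℝ) +
      ∑ y, ∑ z, 3 / 2 ^ L * expKernel (4 * r * L) (x y) (x z) := by
  classical
  obtain ⟨σ, h, hcard, hpow, hdist⟩ := exists_owner_of_reachable x r hw
  have hL0 : (0 : ℝ) < L := by positivity
  have hpos : ∀ y, 0 < w (σ y) := fun y => by
    rw [hcard, Finset.card_pos]
    exact ⟨y, by simp⟩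
  have hkernel : ∀ y z, σ y = σ z → 2 ^ L ≤ w (σ y) →
      1 / (w (σ y) : ℝ) ≤ 3 / 2 ^ L * expKernel (4 * r * L) (x y) (x z) := by
    intro y z hyz hbig
    have hw0 : (0 : ℝ) < w (σ y) := by exact_mod_cast hpos y
    have hd : dist (x y) (x z) ≤ 2 * (h (σ y) * r) := by
      have h1 := hdist y
      have h2 := hdist z
      rw [← hyz, dist_comm] at h2
      linarith [dist_triangle (x y) (x (σ y)) (x z)]
    have h3 := two_pow_mul_exp_le hL hbig (hpow _ (hpos y))
    -- Range `4 * r * L` turns `dist ≤ 2 * h * r` into an exponent of at most `h / L`.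
    calc 1 / (w (σ y) : ℝ) ≤ 3 / 2 ^ L * Real.exp (-(h (σ y) / L)) := by
          rw [Real.exp_neg, ← div_eq_mul_inv, div_div, div_le_div_iff₀ hw0 (by positivity)]
          linarith
      _ ≤ 3 / 2 ^ L * Real.exp (-(2 * dist (x y) (x z) / (4 * r * L))) := by
          refine mul_le_mul_of_nonneg_left (Real.exp_le_exp.2 (neg_le_neg ?_)) (by positivity)
          rw [div_le_div_iff₀ (by positivity) hL0]
          nlinarith [mul_le_mul_of_nonneg_right hd hL0.le]
      _ ≤ _ := by
          gcongr
          exact exp_neg_le_expKernel (by positivity) _ _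
  have hnonneg : ∀ y z, 0 ≤ 3 / 2 ^ L * expKernel (4 * r * L) (x y) (x z) := fun y z =>
    mul_nonneg (by positivity) (expKernel_pos _ _ _).le
  have hlight : ((Finset.univ.filter fun y => w (σ y) < 2 ^ L).card : ℝ) ≤
      2 ^ L * ({v | 0 < w v}.ncard : ℝ) := by
    rw [Set.ncard_eq_toFinset_card', mul_comm]
    have := Finset.card_le_mul_card_image_of_maps_to
      (s := Finset.univ.filter fun y => w (σ y) < 2 ^ L) (t := {v | 0 < w v}.toFinset) (f := σ)
      (fun y _ => by simpa using hpos y) (2 ^ L) (fun v hv => by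
        rw [Finset.filter_filter]
        by_cases hv2 : w v < 2 ^ L
        · refine le_trans (Finset.card_le_card ?_) ((hcard v).symm.le.trans hv2.le)
          intro y
          simp
        · rw [Finset.card_eq_zero.2]
          · exact Nat.zero_le _
          · rw [Finset.filter_eq_empty_iff]
            rintro y _ ⟨h1, h2⟩
            exact hv2 (h2 ▸ h1))
    rw [mul_comm] at this
    exact_mod_cast this
  have hheavy : ((Finset.univ.filter fun y => ¬ w (σ y) < 2 ^ L).card : ℝ) ≤
      ∑ y, ∑ z, 3 / 2 ^ L * expKernel (4 * r * L) (x y) (x z) := by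
    rw [Finset.card_eq_sum_ones, Nat.cast_sum]
    refine le_trans (Finset.sum_le_sum fun y hy => ?_)
      (Finset.sum_le_univ_sum_of_nonneg fun y => Finset.sum_nonneg fun z _ => hnonneg y z)
    simp only [Finset.mem_filter, Finset.mem_univ, true_and, not_lt] at hy
    -- The unit `y` is shared equally among the `w (σ y)` units with the same owner.
    calc ((1 : ℕ) : ℝ) = ∑ z with σ z = σ y, 1 / (w (σ y) : ℝ) := by
          rw [Finset.sum_const, nsmul_eq_mul, ← hcard, mul_one_div_cancel, Nat.cast_one]
          exact_mod_cast (hpos y).ne'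
      _ ≤ ∑ z with σ z = σ y, 3 / 2 ^ L * expKernel (4 * r * L) (x y) (x z) :=
          Finset.sum_le_sum fun z hz => hkernel y z (Finset.mem_filter.1 hz).2.symm hy
      _ ≤ _ := Finset.sum_le_univ_sum_of_nonneg fun z => hnonneg y z
  have hsplit := Finset.card_filter_add_card_filter_not (s := (Finset.univ : Finset V))
    (fun y => w (σ y) < 2 ^ L)
  rw [Finset.card_univ] at hsplit
  rw [← hsplit, Nat.cast_add]
  exact add_le_add hlight hheavy

theorem card_le_totalAcquisitionNumber {V : Type*} [Fintype V]
    (x : V → EuclideanSpace ℝ (Fin 2)) {r : ℝ} (hr : 0 < r) {L : ℕ} (hL : 2 ≤ L) :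
    (Fintype.card V : ℝ) ≤ 2 ^ L * ((SimpleGraph.geometricGraph x r).totalAcquisitionNumber : ℝ) +
      ∑ y, ∑ z, 3 / 2 ^ L * expKernel (4 * r * L) (x y) (x z) := by
  obtain ⟨S, hS⟩ := (SimpleGraph.geometricGraph x r).exists_isResidualSet
  obtain ⟨_, ⟨w, hw, rfl⟩, hk⟩ := Nat.sInf_mem (s := {k : ℕ | ∃ S : Set V,
    (SimpleGraph.geometricGraph x r).IsResidualSet S ∧ S.ncard = k}) ⟨_, S, hS, rfl⟩
  rw [SimpleGraph.totalAcquisitionNumber, ← hk]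
  exact card_le_of_reachable x hr hw.1 hL

/-! ### Second moment of sums over pairs of independent points. -/

section PairSum
open ProbabilityTheory

/-- If the kernel `f` has fibre integrals at most `η`, then so does its integral against an
independent pair, weighted by any nonnegative function of the first variable. -/
theorem integral_mul_kernel_le_of_indepFun {Ω α β : Type*} [MeasurableSpace Ω]
    [MeasurableSpace α] [MeasurableSpace β] {μ : Measure Ω} [IsProbabilityMeasure μ]
    {ν : Measure β} [IsProbabilityMeasure ν] {U : Ω → α} {W : Ω → β} (hU : Measurable U)
    (hW : MeasurePreserving W μ ν) (hind : IndepFun U W μ) {p : α → ℝ} (hp : Measurable p)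
    (hp0 : ∀ u, 0 ≤ p u) (hp1 : ∀ u, p u ≤ 1) {f : α → β → ℝ}
    (hf : Measurable (Function.uncurry f)) (hf0 : ∀ u y, 0 ≤ f u y) (hf1 : ∀ u y, f u y ≤ 1)
    {η : ℝ} (hη : ∀ u, ∫ y, f u y ∂ν ≤ η) :
    ∫ ω, p (U ω) * f (U ω) (W ω) ∂μ ≤ η * ∫ ω, p (U ω) ∂μ := by
  have : IsProbabilityMeasure (μ.map U) := Measure.isProbabilityMeasure_map hU.aemeasurable
  have hm : Measurable fun z : α × β => p z.1 * f z.1 z.2 := (hp.comp measurable_fst).mul hf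
  have hint : Integrable (fun z : α × β => p z.1 * f z.1 z.2) ((μ.map U).prod ν) :=
    Integrable.of_bound hm.aestronglyMeasurable 1 (ae_of_all _ fun z => by
      rw [Real.norm_of_nonneg (mul_nonneg (hp0 _) (hf0 _ _))]
      exact mul_le_one₀ (hp1 _) (hf0 _ _) (hf1 _ _))
  have hmap := (indepFun_iff_map_prod_eq_prod_map_map hU.aemeasurable
    hW.measurable.aemeasurable).1 hind
  rw [hW.map_eq] at hmap
  calc ∫ ω, p (U ω) * f (U ω) (W ω) ∂μ
      = ∫ z, p z.1 * f z.1 z.2 ∂((μ.map U).prod ν) := by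
        rw [← hmap, integral_map (hU.prodMk hW.measurable).aemeasurable hm.aestronglyMeasurable]
    _ = ∫ u, p u * ∫ y, f u y ∂ν ∂(μ.map U) := by
        rw [integral_prod _ hint]
        simp only [integral_const_mul]
    _ ≤ ∫ u, p u * η ∂(μ.map U) := by
        refine integral_mono ?_ ?_ fun u => mul_le_mul_of_nonneg_left (hη u) (hp0 u)
        · simpa only [integral_const_mul] using hint.integral_prod_left
        · exact (Integrable.of_bound hp.aestronglyMeasurable 1 (ae_of_all _ fun u => by
            rw [Real.norm_of_nonneg (hp0 u)]; exact hp1 u)).mul_const η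
    _ = η * ∫ ω, p (U ω) ∂μ := by
        rw [integral_mul_const, mul_comm, integral_map hU.aemeasurable hp.aestronglyMeasurable]

variable {E : Type*} {n : ℕ} {f : E → E → ℝ}

/-- The contribution of the ordered pair `p` of indices to the sum of `f` over pairs of distinct
points. -/
def pairTerm (f : E → E → ℝ) (p : Fin n × Fin n) (x : Fin n → E) : ℝ :=
  if p.1 = p.2 then 0 else f (x p.1) (x p.2)

theorem pairTerm_nonneg (hf0 : ∀ u y, 0 ≤ f u y) (p : Fin n × Fin n) (x : Fin n → E) :
    0 ≤ pairTerm f p x := by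
  unfold pairTerm
  split_ifs
  exacts [le_rfl, hf0 _ _]

theorem pairTerm_le_one (hf1 : ∀ u y, f u y ≤ 1) (p : Fin n × Fin n) (x : Fin n → E) :
    pairTerm f p x ≤ 1 := by
  unfold pairTerm
  split_ifs
  exacts [zero_le_one, hf1 _ _]

theorem pairTerm_swap (hsymm : ∀ u y, f u y = f y u) (p : Fin n × Fin n) (x : Fin n → E) :
    pairTerm f p.swap x = pairTerm f p x := by
  simp only [pairTerm, Prod.fst_swap, Prod.snd_swap, eq_comm (a := p.2), hsymm (x p.2)]

variable [MeasurableSpace E] {ν : Measure E} [IsProbabilityMeasure ν] {η : ℝ}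

theorem iIndepFun_eval_pi (ν : Measure E) [IsProbabilityMeasure ν] (n : ℕ) :
    iIndepFun (fun (i : Fin n) (x : Fin n → E) => x i) (Measure.pi fun _ => ν) :=
  iIndepFun_pi (X := fun _ => id) fun _ => aemeasurable_id

theorem measurable_pairTerm (hf : Measurable (Function.uncurry f)) (p : Fin n × Fin n) :
    Measurable (pairTerm f p) := by
  unfold pairTerm
  split_ifs
  · exact measurable_const
  · have h : Measurable fun x : Fin n → E => (x p.1, x p.2) :=
      (measurable_pi_apply _).prodMk (measurable_pi_apply _)
    exact hf.comp h

theorem memLp_pairTerm (hf : Measurable (Function.uncurry f)) (hf0 : ∀ u y, 0 ≤ f u y)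
    (hf1 : ∀ u y, f u y ≤ 1) (p : Fin n × Fin n) :
    MemLp (pairTerm f p) 2 (Measure.pi fun _ => ν) :=
  MemLp.of_bound (measurable_pairTerm hf p).aestronglyMeasurable 1 (ae_of_all _ fun x => by
    rw [Real.norm_of_nonneg (pairTerm_nonneg hf0 p x)]
    exact pairTerm_le_one hf1 p x)

theorem integral_pairTerm_le (hf : Measurable (Function.uncurry f)) (hf0 : ∀ u y, 0 ≤ f u y)
    (hf1 : ∀ u y, f u y ≤ 1) (hη : ∀ u, ∫ y, f u y ∂ν ≤ η) (hη0 : 0 ≤ η) (p : Fin n × Fin n) :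
    ∫ x, pairTerm f p x ∂(Measure.pi fun _ => ν) ≤ η := by
  unfold pairTerm
  split_ifs with h
  · simpa using hη0
  · simpa using integral_mul_kernel_le_of_indepFun (measurable_pi_apply p.1)
      (measurePreserving_eval (fun _ => ν) p.2) ((iIndepFun_eval_pi ν n).indepFun h)
      (p := fun _ => 1) measurable_const (by simp) (by simp) hf hf0 hf1 hη

/-- The point of index `l` is independent of the pair `p`: integrating it out gives one factor `η`,
and the pair `p` gives the other. -/
theorem integral_pairTerm_mul_pairTerm_le (hf : Measurable (Function.uncurry f))
    (hf0 : ∀ u y, 0 ≤ f u y) (hf1 : ∀ u y, f u y ≤ 1) (hη : ∀ u, ∫ y, f u y ∂ν ≤ η)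
    (hη0 : 0 ≤ η) {p : Fin n × Fin n} {k l : Fin n} (hk : k = p.1 ∨ k = p.2) (hl1 : p.1 ≠ l)
    (hl2 : p.2 ≠ l) :
    ∫ x, pairTerm f p x * pairTerm f (k, l) x ∂(Measure.pi fun _ => ν) ≤ η ^ 2 := by
  have hkl : k ≠ l := by rintro rfl; tauto
  by_cases hp : p.1 = p.2
  · simp only [pairTerm, hp, if_true, zero_mul, integral_zero]
    positivity
  have hind := (iIndepFun_eval_pi ν n).indepFun_prodMk (fun i => measurable_pi_apply i)
    p.1 p.2 l hl1 hl2
  have hU : Measurable fun x : Fin n → E => (x p.1, x p.2) :=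
    (measurable_pi_apply _).prodMk (measurable_pi_apply _)
  -- The projection `g` selects which point of `p` is shared with the second pair.
  have hmain : ∀ g : E × E → E, Measurable g →
      ∫ x : Fin n → E, f (x p.1) (x p.2) * f (g (x p.1, x p.2)) (x l) ∂(Measure.pi fun _ => ν)
        ≤ η * ∫ x : Fin n → E, f (x p.1) (x p.2) ∂(Measure.pi fun _ => ν) := fun g hg =>
    integral_mul_kernel_le_of_indepFun hU (measurePreserving_eval (fun _ => ν) l) hind
      (p := Function.uncurry f) hf (fun _ => hf0 _ _) (fun _ => hf1 _ _)
      (f := fun u y => f (g u) y) (hf.comp ((hg.comp measurable_fst).prodMk measurable_snd))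
      (fun _ _ => hf0 _ _) (fun _ _ => hf1 _ _) (fun _ => hη _)
  have h1 := integral_pairTerm_le (ν := ν) hf hf0 hf1 hη hη0 p
  simp only [pairTerm, hp, if_false] at h1
  simp only [pairTerm, hp, hkl, if_false]
  have h2 : η * ∫ x : Fin n → E, f (x p.1) (x p.2) ∂(Measure.pi fun _ => ν) ≤ η ^ 2 := by
    rw [sq]
    exact mul_le_mul_of_nonneg_left h1 hη0
  rcases hk with rfl | rfl
  · exact (hmain Prod.fst measurable_fst).trans h2
  · exact (hmain Prod.snd measurable_snd).trans h2

theorem pair_share_one {α : Type*} {i j k l : α} (hkl : k ≠ l)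
    (hsame : ¬ ((i = k ∧ j = l) ∨ (i = l ∧ j = k))) (hshare : i = k ∨ i = l ∨ j = k ∨ j = l) :
    ((k = i ∨ k = j) ∧ i ≠ l ∧ j ≠ l) ∨ ((l = i ∨ l = j) ∧ i ≠ k ∧ j ≠ k) := by
  grind

/-- Disjoint pairs are independent, pairs sharing one index give `η ^ 2`, and equal or swapped pairs
give `η` because terms are at most 1. Indicators are added rather than split into cases so that they
can be summed directly. -/
theorem covariance_pairTerm_le (hf : Measurable (Function.uncurry f))
    (hf0 : ∀ u y, 0 ≤ f u y) (hf1 : ∀ u y, f u y ≤ 1) (hsymm : ∀ u y, f u y = f y u)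
    (hη : ∀ u, ∫ y, f u y ∂ν ≤ η) (hη0 : 0 ≤ η) (p q : Fin n × Fin n) :
    cov[pairTerm f p, pairTerm f q; Measure.pi fun _ => ν] ≤
      η ^ 2 * ((if p.1 = q.1 then 1 else 0) + (if p.1 = q.2 then 1 else 0) +
        (if p.2 = q.1 then 1 else 0) + (if p.2 = q.2 then 1 else 0)) +
      η * ((if p.1 = q.1 ∧ p.2 = q.2 then 1 else 0) +
        (if p.1 = q.2 ∧ p.2 = q.1 then 1 else 0)) := by
  have hcov : cov[pairTerm f p, pairTerm f q; Measure.pi fun _ => ν] ≤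
      ∫ x, pairTerm f p x * pairTerm f q x ∂(Measure.pi fun _ => ν) := by
    rw [covariance_eq_sub (memLp_pairTerm hf hf0 hf1 p) (memLp_pairTerm hf hf0 hf1 q)]
    simp only [Pi.mul_apply, sub_le_self_iff]
    exact mul_nonneg (integral_nonneg fun x => pairTerm_nonneg hf0 p x)
      (integral_nonneg fun x => pairTerm_nonneg hf0 q x)
  have hη2 : 0 ≤ η ^ 2 := sq_nonneg η
  have hle : ∫ x, pairTerm f p x * pairTerm f q x ∂(Measure.pi fun _ => ν) ≤ η := by
    refine le_trans (integral_mono_of_nonneg (ae_of_all _ fun x =>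
      mul_nonneg (pairTerm_nonneg hf0 p x) (pairTerm_nonneg hf0 q x))
      ((memLp_pairTerm hf hf0 hf1 p).integrable (by norm_num)) (ae_of_all _ fun x =>
        mul_le_of_le_one_right (pairTerm_nonneg hf0 p x) (pairTerm_le_one hf1 q x)))
      (integral_pairTerm_le hf hf0 hf1 hη hη0 p)
  obtain ⟨k, l⟩ := q
  have hkl : (k = p.1 ∨ k = p.2) → p.1 ≠ l → p.2 ≠ l →
      ∫ x, pairTerm f p x * pairTerm f (k, l) x ∂(Measure.pi fun _ => ν) ≤ η ^ 2 :=
    integral_pairTerm_mul_pairTerm_le hf hf0 hf1 hη hη0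
  have hlk : (l = p.1 ∨ l = p.2) → p.1 ≠ k → p.2 ≠ k →
      ∫ x, pairTerm f p x * pairTerm f (k, l) x ∂(Measure.pi fun _ => ν) ≤ η ^ 2 := by
    intro h1 h2 h3
    simpa only [← pairTerm_swap hsymm (l, k), Prod.swap_prod_mk] using
      integral_pairTerm_mul_pairTerm_le hf hf0 hf1 hη hη0 h1 h2 h3
  have hdisj : p.1 ≠ k → p.1 ≠ l → p.2 ≠ k → p.2 ≠ l →
      cov[pairTerm f p, pairTerm f (k, l); Measure.pi fun _ => ν] = 0 := by
    intro h1 h2 h3 h4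
    have hind := (iIndepFun_eval_pi ν n).indepFun_prodMk_prodMk (fun i => measurable_pi_apply i)
      p.1 p.2 k l h1 h2 h3 h4
    have hmeas : ∀ q : Fin n × Fin n, Measurable fun z : E × E =>
        if q.1 = q.2 then (0 : ℝ) else f z.1 z.2 := fun q => by
      split_ifs
      · exact measurable_const
      · exact hf
    exact (hind.comp (hmeas p) (hmeas (k, l))).covariance_eq_zero
      (memLp_pairTerm hf hf0 hf1 p) (memLp_pairTerm hf hf0 hf1 (k, l))
  obtain ⟨i, j⟩ := p
  simp only at hkl hlk hdisj ⊢
  by_cases hij : i = j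
  · subst hij
    have h0 : cov[pairTerm f (i, i), pairTerm f (k, l); Measure.pi fun _ => ν] ≤ 0 := by
      refine hcov.trans (le_of_eq ?_)
      simp [pairTerm]
    refine h0.trans ?_
    positivity
  by_cases hkl' : k = l
  · subst hkl'
    have h0 : cov[pairTerm f (i, j), pairTerm f (k, k); Measure.pi fun _ => ν] ≤ 0 := by
      refine hcov.trans (le_of_eq ?_)
      simp [pairTerm]
    refine h0.trans ?_
    positivity
  by_cases hsame : (i = k ∧ j = l) ∨ (i = l ∧ j = k)
  · have h1 : (1 : ℝ) ≤ (if i = k ∧ j = l then 1 else 0) + (if i = l ∧ j = k then 1 else 0) := by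
      rcases hsame with h | h <;> rw [if_pos h] <;> split_ifs <;> norm_num
    refine (hcov.trans hle).trans ((le_mul_of_one_le_right hη0 h1).trans
      (le_add_of_nonneg_left ?_))
    positivity
  by_cases hshare : i = k ∨ i = l ∨ j = k ∨ j = l
  · have h1 : (1 : ℝ) ≤ (if i = k then 1 else 0) + (if i = l then 1 else 0) +
        (if j = k then 1 else 0) + (if j = l then 1 else 0) := by
      rcases hshare with h | h | h | h <;> rw [if_pos h] <;> split_ifs <;> norm_num
    have h2 : ∫ x, pairTerm f (i, j) x * pairTerm f (k, l) x ∂(Measure.pi fun _ => ν) ≤ η ^ 2 := by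
      rcases pair_share_one hkl' hsame hshare with ⟨h, h', h''⟩ | ⟨h, h', h''⟩
      · exact hkl h h' h''
      · exact hlk h h' h''
    refine (hcov.trans h2).trans ((le_mul_of_one_le_right hη2 h1).trans
      (le_add_of_nonneg_right ?_))
    positivity
  · push Not at hshare
    rw [hdisj hshare.1 hshare.2.1 hshare.2.2.1 hshare.2.2.2]
    positivity

theorem variance_sum_pairTerm_le (hf : Measurable (Function.uncurry f))
    (hf0 : ∀ u y, 0 ≤ f u y) (hf1 : ∀ u y, f u y ≤ 1) (hsymm : ∀ u y, f u y = f y u)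
    (hη : ∀ u, ∫ y, f u y ∂ν ≤ η) (hη0 : 0 ≤ η) :
    Var[∑ p : Fin n × Fin n, pairTerm f p; Measure.pi fun _ => ν] ≤
      4 * n ^ 3 * η ^ 2 + 2 * n ^ 2 * η := by
  rw [variance_sum (memLp_pairTerm hf hf0 hf1)]
  refine (Finset.sum_le_sum fun p _ => Finset.sum_le_sum fun q _ =>
    covariance_pairTerm_le hf hf0 hf1 hsymm hη hη0 p q).trans (le_of_eq ?_)
  have h1 : ∑ p : Fin n × Fin n, ∑ q : Fin n × Fin n, (if p.1 = q.1 then (1 : ℝ) else 0) =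
      n ^ 3 := by
    simp [Fintype.sum_prod_type_right, -Finset.sum_boole]; ring
  have h2 : ∑ p : Fin n × Fin n, ∑ q : Fin n × Fin n, (if p.1 = q.2 then (1 : ℝ) else 0) =
      n ^ 3 := by
    simp [Fintype.sum_prod_type, -Finset.sum_boole]; ring
  have h3 : ∑ p : Fin n × Fin n, ∑ q : Fin n × Fin n, (if p.2 = q.1 then (1 : ℝ) else 0) =
      n ^ 3 := by
    simp [Fintype.sum_prod_type_right, -Finset.sum_boole]; ring
  have h4 : ∑ p : Fin n × Fin n, ∑ q : Fin n × Fin n, (if p.2 = q.2 then (1 : ℝ) else 0) =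
      n ^ 3 := by
    simp [Fintype.sum_prod_type, -Finset.sum_boole]; ring
  have h5 : ∑ p : Fin n × Fin n, ∑ q : Fin n × Fin n,
      (if p.1 = q.1 ∧ p.2 = q.2 then (1 : ℝ) else 0) = n ^ 2 := by
    simp [Fintype.sum_prod_type, ite_and]; ring
  have h6 : ∑ p : Fin n × Fin n, ∑ q : Fin n × Fin n,
      (if p.1 = q.2 ∧ p.2 = q.1 then (1 : ℝ) else 0) = n ^ 2 := by
    simp [Fintype.sum_prod_type, ite_and]; ring
  simp only [Finset.sum_add_distrib, ← Finset.mul_sum, h1, h2, h3, h4, h5, h6]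
  ring

end PairSum

/-! ### The kernel under the uniform law on the square. -/

theorem integral_exp_neg_abs_div {a : ℝ} (ha : 0 < a) :
    ∫ t : ℝ, Real.exp (-(|t| / a)) = 2 * a := by
  rw [integral_comp_abs (f := fun t => Real.exp (-(t / a)))]
  have h := integral_exp_mul_Ioi (a := -a⁻¹) (by simpa using ha) 0
  have h2 : ∀ t : ℝ, -(t / a) = -a⁻¹ * t := fun t => by ring
  simp only [h2, h]
  simp

theorem continuous_expKernel (a : ℝ) : Continuous (Function.uncurry (expKernel a)) := by
  unfold Function.uncurry expKernel
  fun_prop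

theorem integral_expKernel {a : ℝ} (ha : 0 < a) (p : EuclideanSpace ℝ (Fin 2)) :
    ∫ q, expKernel a p q = (2 * a) ^ 2 := by
  have h := (PiLp.volume_preserving_ofLp (Fin 2)).integral_comp
    (MeasurableEquiv.toLp 2 (Fin 2 → ℝ)).symm.measurableEmbedding
    (fun y : Fin 2 → ℝ => ∏ i, Real.exp (-(|p i - y i| / a)))
  have h2 : ∀ i : Fin 2, ∫ t : ℝ, Real.exp (-(|p i - t| / a)) = 2 * a := fun i => by
    rw [integral_sub_left_eq_self (fun t : ℝ => Real.exp (-(|t| / a))) volume (p i),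
      integral_exp_neg_abs_div ha]
  have h3 := integral_fintype_prod_volume_eq_prod
    (fun (i : Fin 2) (t : ℝ) => Real.exp (-(|p i - t| / a)))
  simp only [h2, Finset.prod_const, Finset.card_univ, Fintype.card_fin] at h3
  exact h.trans h3

theorem integrable_expKernel {a : ℝ} (ha : 0 < a) (p : EuclideanSpace ℝ (Fin 2)) :
    Integrable (expKernel a p) :=
  -- A non-integrable function would have integral 0 by convention.
  Integrable.of_integral_ne_zero (by rw [integral_expKernel ha]; positivity)

theorem volume_rggSquare (n : ℕ) : volume (rggSquare n) = n := by
  have h : rggSquare n = WithLp.ofLp ⁻¹' Set.Icc (0 : Fin 2 → ℝ) fun _ => Real.sqrt n := by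
    ext p
    simp [rggSquare, Pi.le_def, forall_and]
  rw [h, (PiLp.volume_preserving_ofLp (Fin 2)).measure_preimage measurableSet_Icc.nullMeasurableSet,
    Real.volume_Icc_pi]
  simp [← ENNReal.ofReal_pow]

theorem isProbabilityMeasure_cond_rggSquare {n : ℕ} (hn : 1 ≤ n) :
    IsProbabilityMeasure (ProbabilityTheory.cond volume (rggSquare n)) :=
  ProbabilityTheory.cond_isProbabilityMeasure_of_finite
    (by rw [volume_rggSquare]; exact_mod_cast (by omega)) (by simp [volume_rggSquare])

theorem integral_expKernel_cond_le {a : ℝ} (ha : 0 < a) (n : ℕ) (p : EuclideanSpace ℝ (Fin 2)) :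
    ∫ q, expKernel a p q ∂(ProbabilityTheory.cond volume (rggSquare n)) ≤ (2 * a) ^ 2 / n := by
  rw [ProbabilityTheory.cond, integral_smul_measure, volume_rggSquare, ← integral_expKernel ha p,
    div_eq_inv_mul]
  simp only [ENNReal.toReal_inv, ENNReal.toReal_natCast, smul_eq_mul]
  refine mul_le_mul_of_nonneg_left ?_ (by positivity)
  exact setIntegral_le_integral (integrable_expKernel ha p)
    (ae_of_all _ fun q => (expKernel_pos a p q).le)

theorem sum_sum_eq_sum_pairTerm {E : Type*} {n : ℕ} {f : E → E → ℝ} {b : ℝ}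
    (hb : ∀ u, f u u = b) (x : Fin n → E) :
    ∑ i, ∑ j, f (x i) (x j) = n * b + (∑ p : Fin n × Fin n, pairTerm f p) x := by
  have h : ∀ i j, f (x i) (x j) = (if i = j then b else 0) + pairTerm f (i, j) x := by
    intro i j
    unfold pairTerm
    by_cases hij : i = j
    · simp [hij, hb]
    · simp [hij]
  simp only [Finset.sum_apply, Fintype.sum_prod_type]
  simp only [h, Finset.sum_add_distrib]
  simp

/-! ### Chebyshev's inequality, choice of the scale, conclusion. -/

theorem rggPoints_totalAcquisitionNumber_ge {n : ℕ} (hn : 1 ≤ n) {r : ℝ} (hr : 2 ≤ r) {L : ℕ}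
    (hL : 2 ≤ L) (hrL : 768 * (r * L) ^ 2 ≤ 2 ^ L) :
    1 - ENNReal.ofReal (48 / n) ≤ rggPoints n
      {x | (n : ℝ) / 2 ^ (L + 1) ≤
        ((SimpleGraph.geometricGraph x r).totalAcquisitionNumber : ℝ)} := by
  have := isProbabilityMeasure_cond_rggSquare hn
  have hn0 : (0 : ℝ) < n := by positivity
  have hL0 : (0 : ℝ) < L := by positivity
  have hr0 : 0 < r := by linarith
  have ha : 0 < 4 * r * L := by positivity
  have h2L : (0 : ℝ) < 2 ^ L := by positivity
  have hA : (3 : ℝ) / 2 ^ L ≤ 1 / 8 := by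
    have h1 : (4 : ℝ) ≤ r * L := by
      have : (2 : ℝ) ≤ L := by exact_mod_cast hL
      nlinarith
    rw [div_le_div_iff₀ h2L (by norm_num)]
    nlinarith
  set f : EuclideanSpace ℝ (Fin 2) → EuclideanSpace ℝ (Fin 2) → ℝ :=
    fun p q => 3 / 2 ^ L * expKernel (4 * r * L) p q with hf_def
  have hf : Measurable (Function.uncurry f) :=
    (continuous_const.mul (continuous_expKernel (4 * r * L))).measurable
  have hf0 : ∀ p q, 0 ≤ f p q := fun p q =>
    mul_nonneg (by positivity) (expKernel_pos _ _ _).le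
  have hf1 : ∀ p q, f p q ≤ 1 := fun p q =>
    mul_le_one₀ (by linarith) (expKernel_pos _ _ _).le (expKernel_le_one ha.le _ _)
  have hsymm : ∀ p q, f p q = f q p := fun p q => by simp only [hf_def, expKernel_comm _ p q]
  set η : ℝ := 1 / (4 * n) with hη_def
  have hη0 : 0 ≤ η := by positivity
  have hη : ∀ p, ∫ q, f p q ∂(ProbabilityTheory.cond volume (rggSquare n)) ≤ η := fun p => by
    simp only [hf_def, integral_const_mul]
    calc 3 / 2 ^ L * ∫ q, expKernel (4 * r * L) p q ∂(ProbabilityTheory.cond volume (rggSquare n))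
        ≤ 3 / 2 ^ L * ((2 * (4 * r * L)) ^ 2 / n) := by
          gcongr
          exact integral_expKernel_cond_le ha n p
      -- Here `768 = 4 * 3 * 8 ^ 2`.
      _ = 768 * (r * L) ^ 2 / 2 ^ L * η := by rw [hη_def]; field_simp; ring
      _ ≤ 1 * η := by
          gcongr
          rwa [div_le_one h2L]
      _ = η := one_mul η
  set S : (Fin n → EuclideanSpace ℝ (Fin 2)) → ℝ := ∑ p : Fin n × Fin n, pairTerm f p with hS
  have hSmem : MemLp S 2 (rggPoints n) := memLp_finsetSum' _ fun p _ => memLp_pairTerm hf hf0 hf1 p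
  have hmean : ∫ x, S x ∂(rggPoints n) ≤ n / 4 := by
    simp only [hS, Finset.sum_apply, rggPoints]
    rw [integral_finsetSum _ fun p _ =>
      (memLp_pairTerm hf hf0 hf1 p).integrable (by norm_num)]
    refine (Finset.sum_le_sum fun p _ =>
      integral_pairTerm_le hf hf0 hf1 hη hη0 p).trans (le_of_eq ?_)
    simp only [Finset.sum_const, Finset.card_univ, Fintype.card_prod, Fintype.card_fin,
      nsmul_eq_mul, hη_def]
    push_cast
    field_simp
  have hvar : ProbabilityTheory.variance S (rggPoints n) ≤ 3 / 4 * n := by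
    refine (variance_sum_pairTerm_le hf hf0 hf1 hsymm hη hη0).trans (le_of_eq ?_)
    rw [hη_def]
    field_simp
    ring
  have : IsProbabilityMeasure (rggPoints n) := by unfold rggPoints; infer_instance
  have hcheb := ProbabilityTheory.meas_ge_le_variance_div_sq hSmem
    (c := (n : ℝ) / 8) (by positivity)
  have hbound : rggPoints n {x | (n : ℝ) / 8 ≤ |S x - ∫ y, S y ∂(rggPoints n)|} ≤
      ENNReal.ofReal (48 / n) := by
    refine hcheb.trans (ENNReal.ofReal_le_ofReal ?_)
    rw [div_le_div_iff₀ (by positivity) hn0]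
    nlinarith
  refine (tsub_le_tsub_left hbound 1).trans ?_
  rw [tsub_le_iff_right, ← measure_univ (μ := rggPoints n)]
  refine (measure_mono fun x _ => ?_).trans (measure_union_le _ _)
  by_cases hx : (n : ℝ) / 8 ≤ |S x - ∫ y, S y ∂(rggPoints n)|
  · exact Or.inr hx
  · refine Or.inl ?_
    -- The mean takes `n / 4`, the deviation `n / 8` and the diagonal `n / 8`; light vertices hold
    -- the remaining `n / 2`.
    have h1 := (abs_lt.1 (not_le.1 hx)).2
    have h2 := card_le_totalAcquisitionNumber x hr0 hL
    have h3 := sum_sum_eq_sum_pairTerm (f := f) (b := 3 / 2 ^ L)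
      (fun u => by simp [hf_def, expKernel_self]) x
    rw [Fintype.card_fin] at h2
    have h4 : (n : ℝ) * (3 / 2 ^ L) ≤ n * (1 / 8) := by gcongr
    simp only [Set.mem_ofPred_eq]
    rw [div_le_iff₀ (by positivity), pow_succ]
    change (n : ℝ) ≤ _ + ∑ y, ∑ z, f (x y) (x z) at h2
    rw [h3] at h2
    linarith

/-- A number `L` of hops suited to the radius `r`. -/
theorem exists_hop_scale {r : ℝ} (hr : 2 ≤ r) :
    ∃ L : ℕ, 2 ≤ L ∧ 768 * (r * L) ^ 2 ≤ 2 ^ L ∧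
      (2 : ℝ) ^ (L + 1) ≤ 2 ^ 22 * (r * Real.logb 2 r) ^ 2 := by
  have hr0 : 0 < r := by linarith
  set l := Real.logb 2 r with hl
  have hl1 : 1 ≤ l := by
    rw [hl, Real.le_logb_iff_rpow_le (by norm_num) hr0]
    simpa using hr
  have hrl : (2 : ℝ) ^ l = r := Real.rpow_logb (by norm_num) (by norm_num) hr0
  have hlr : l ≤ r := by
    have := one_add_mul_self_le_rpow_one_add (s := 1) (by norm_num) hl1
    norm_num [hrl] at this
    linarith
  have hs : 2 ≤ r * l := by nlinarith
  -- The factor `2 ^ 20` exceeds `768 * 25 ^ 2`, where 25 comes from `L ≤ 21 + 4 * l ≤ 25 * l`.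
  obtain ⟨m, hm1, hm2⟩ := exists_nat_pow_near (x := 2 ^ 20 * (r * l) ^ 2) (y := (2 : ℝ))
    (by nlinarith) (by norm_num)
  have hm2' : (2 : ℝ) ^ 20 * (r * l) ^ 2 < 2 ^ (m + 1) := hm2
  have hub : (2 : ℝ) ^ (m + 1) ≤ 2 ^ 21 * (r * l) ^ 2 := by
    rw [pow_succ]
    linarith
  have hL : ((m + 1 : ℕ) : ℝ) ≤ 25 * l := by
    have h1 : (2 : ℝ) ^ ((m + 1 : ℕ) : ℝ) ≤ 2 ^ (21 + 4 * l) := by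
      rw [Real.rpow_natCast, Real.rpow_add (by norm_num), mul_comm 4 l, Real.rpow_mul (by norm_num),
        hrl]
      refine hub.trans ?_
      have h2 : (r * l) ^ 2 ≤ (r * r) ^ 2 := by gcongr
      norm_num
      nlinarith
    have h3 := (Real.rpow_le_rpow_left_iff (by norm_num : (1 : ℝ) < 2)).1 h1
    linarith
  refine ⟨m + 1, ?_, ?_, ?_⟩
  · by_contra h
    have h0 : m = 0 := by omega
    subst h0
    have h1 : (2 : ℝ) ^ 2 ≤ (r * l) ^ 2 := by gcongr
    norm_num at hm2' h1
    linarith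
  · calc 768 * (r * ((m + 1 : ℕ) : ℝ)) ^ 2 ≤ 768 * (r * (25 * l)) ^ 2 := by gcongr
      _ ≤ 2 ^ 20 * (r * l) ^ 2 := by nlinarith [sq_nonneg (r * l)]
      _ ≤ 2 ^ (m + 1) := hm2'.le
  · rw [pow_succ]
    linarith

theorem theorem2p4 :
    ∃ c : ℝ, 1 < c ∧ ∃ δ : ℝ, 0 < δ ∧
      ∀ r : ℕ → ℝ, (∀ n, 1 ≤ n → c ≤ r n) →
        Tendsto
          (fun n : ℕ => rggPoints n
            {x | δ * ((n : ℝ) / (r n * Real.logb 2 (r n)) ^ 2) ≤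
              ((SimpleGraph.geometricGraph x (r n)).totalAcquisitionNumber : ℝ)})
          atTop (𝓝 1) := by
  refine ⟨2, by norm_num, 1 / 2 ^ 22, by positivity, fun r hr => ?_⟩
  have hlim : Tendsto (fun n : ℕ => 1 - ENNReal.ofReal (48 / (n : ℝ))) atTop (𝓝 1) := by
    have h := ENNReal.tendsto_ofReal (tendsto_const_div_atTop_nhds_zero_nat (48 : ℝ))
    simpa using ENNReal.Tendsto.sub tendsto_const_nhds h (Or.inl ENNReal.one_ne_top)
  refine tendsto_of_tendsto_of_tendsto_of_le_of_le' hlim tendsto_const_nhds ?_ ?_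
  · filter_upwards [eventually_ge_atTop 1] with n hn
    obtain ⟨L, hL, hrL, hpow⟩ := exists_hop_scale (hr n hn)
    refine (rggPoints_totalAcquisitionNumber_ge hn (hr n hn) hL hrL).trans
      (measure_mono fun x hx => ?_)
    simp only [Set.mem_ofPred_eq] at hx ⊢
    refine le_trans ?_ hx
    rw [one_div_mul_eq_div, div_div, mul_comm]
    gcongr
  · filter_upwards [eventually_ge_atTop 1] with n hn
    have := isProbabilityMeasure_cond_rggSquare hn
    have : IsProbabilityMeasure (rggPoints n) := by unfold rggPoints; infer_instance
    exact prob_le_one
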